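/- Let $R$ be a commutative noetherian local ring with residue field $k$, let $M$ be a finitely generated $R$-module and let $n \geqslant 0$ be an integer. For finitely generated $R$-modules $A,B$ let $\underline{\mathrm{Hom}}_R(A,B)$ be the quotient of $\mathrm{Hom}_R(A,B)$ by the submodule of homomorphisms that factor through a projective module, and let $\Omega$ be the syzygy functor on the resulting stable category of finitely generated $R$-modules ($\Omega A$ is the kernel of a surjection from a finitely generated projective module onto $A$, and $\Omega f$ is induced by lifting $f$ to these projective modules). Define the $n$-th approximated $\xi$-invariant of $M$ by $$\xi_R(n,M)=\dim_k \mathrm{Ker}\big(\mathrm{Hom}_R(M,k)\to\underline{\mathrm{Hom}}_R(M,k)\xrightarrow{\Omega^n}\underline{\mathrm{Hom}}_R(\Omega^nM,\Omega^nk)\big).$$ Let $\mathscr{E}_n(R)$ be the class of finitely generated $R$-modules $M$ having an $n$-origin extension, that is, a short exact sequence $0\to X\to M\oplus P\to Y\to 0$ of finitely generated $R$-modules such that $P$ is projective, $\operatorname{pd}_R Y\leqslant n$, and $\operatorname{Ext}^i_R(X,R)=0$ for all $1\leqslant i\leqslant n$. Consider the following conditions: 1. One has $\xi_R(n,M)=0$.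 2. Every $R$-homomorphism $f:M\to Z$, where $Z$ is a finitely generated $R$-module with $\operatorname{pd}_R Z\leqslant n$, satisfies $f\otimes_R k=0$. Then the implication (1) $\Rightarrow$ (2) always holds. The converse (2) $\Rightarrow$ (1) holds if $M\in\mathscr{E}_n(R)$. -/

import Mathlib

open CategoryTheory

universe u

namespace StableModule

section StableCategory

variable (R : Type u) [CommRing R]

/-- `𝒫(M, N)`: the submodule of `Hom_R(M, N)` consisting of the homomorphisms that factor
through some projective module. -/
def projHom (M N : Type u) [AddCommGroup M] [Module R M] [AddCommGroup N] [Module R N] :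
    Submodule R (M →ₗ[R] N) where
  carrier := {f | ∃ (P : ModuleCat.{u} R) (a : M →ₗ[R] P) (b : P →ₗ[R] N),
    Module.Projective R P ∧ f = b ∘ₗ a}
  zero_mem' := ⟨ModuleCat.of R PUnit.{u + 1}, 0, 0,
    inferInstanceAs (Module.Projective R PUnit.{u + 1}), by simp⟩
  add_mem' := by
    rintro f g ⟨P, a, b, hP, rfl⟩ ⟨Q, c, d, hQ, rfl⟩
    refine ⟨ModuleCat.of R (P × Q), a.prod c, b.coprod d,
      inferInstanceAs (Module.Projective R (P × Q)), ?_⟩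
    ext x
    simp
  smul_mem' := by
    rintro r f ⟨P, a, b, hP, rfl⟩
    exact ⟨P, a, r • b, hP, by ext x; simp⟩

/-- The morphisms of the stable category, `Hom_R(M, N) / 𝒫(M, N)`. -/
abbrev StableHom (M N : Type u) [AddCommGroup M] [Module R M] [AddCommGroup N] [Module R N] :
    Type u :=
  (M →ₗ[R] N) ⧸ projHom R M N

variable {R}

/-- The rank of the finite free module chosen to cover the finitely generated module `M`. -/
noncomputable def coverRank (M : FGModuleCat.{u} R) : ℕ :=
  (Module.Finite.exists_fin' R M).choose

/-- A chosen surjection `R ^ r → M` from a finite free module. -/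
noncomputable def cover (M : FGModuleCat.{u} R) : (Fin (coverRank M) → R) →ₗ[R] M :=
  (Module.Finite.exists_fin' R M).choose_spec.choose

theorem cover_surjective (M : FGModuleCat.{u} R) : Function.Surjective (cover M) :=
  (Module.Finite.exists_fin' R M).choose_spec.choose_spec

/-- The syzygy `Ω M`: the kernel of the chosen surjection from a finite free module. -/
noncomputable def syz [IsNoetherianRing R] (M : FGModuleCat.{u} R) : FGModuleCat.{u} R :=
  FGModuleCat.of R (LinearMap.ker (cover M))

/-- `g : Ω M → Ω N` is a syzygy of `f : M → N` if it is the restriction of a lift of `f` to the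
chosen free covers. -/
def IsSyzMap {M N : FGModuleCat.{u} R} (f : M →ₗ[R] N)
    (g : LinearMap.ker (cover M) →ₗ[R] LinearMap.ker (cover N)) : Prop :=
  ∃ h : (Fin (coverRank M) → R) →ₗ[R] (Fin (coverRank N) → R),
    cover N ∘ₗ h = f ∘ₗ cover M ∧ ∀ x, (g x : Fin (coverRank N) → R) = h x

theorem exists_isSyzMap {M N : FGModuleCat.{u} R} (f : M →ₗ[R] N) :
    ∃ g, IsSyzMap f g := by
  obtain ⟨h, hh⟩ := Module.projective_lifting_property (cover N) (f ∘ₗ cover M)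
    (cover_surjective N)
  have key : ∀ x ∈ LinearMap.ker (cover M), h x ∈ LinearMap.ker (cover N) := by
    intro x hx
    have := LinearMap.congr_fun hh x
    simp only [LinearMap.comp_apply] at this
    rw [LinearMap.mem_ker] at hx ⊢
    rw [this, hx, map_zero]
  exact ⟨h.restrict key, h, hh, fun x => rfl⟩

theorem IsSyzMap.add {M N : FGModuleCat.{u} R} {f f' : M →ₗ[R] N}
    {g g' : LinearMap.ker (cover M) →ₗ[R] LinearMap.ker (cover N)}
    (hg : IsSyzMap f g) (hg' : IsSyzMap f' g') : IsSyzMap (f + f') (g + g') := by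
  obtain ⟨h, hh, hr⟩ := hg
  obtain ⟨h', hh', hr'⟩ := hg'
  exact ⟨h + h', by rw [LinearMap.comp_add, hh, hh', LinearMap.add_comp],
    fun x => by simp [hr, hr']⟩

theorem IsSyzMap.smul {M N : FGModuleCat.{u} R} {f : M →ₗ[R] N}
    {g : LinearMap.ker (cover M) →ₗ[R] LinearMap.ker (cover N)}
    (r : R) (hg : IsSyzMap f g) : IsSyzMap (r • f) (r • g) := by
  obtain ⟨h, hh, hr⟩ := hg
  exact ⟨r • h, by rw [LinearMap.comp_smul, hh, LinearMap.smul_comp],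
    fun x => by simp [hr]⟩

/-- Every syzygy of a map that factors through a projective module does so as well. -/
theorem IsSyzMap.mem_projHom {M N : FGModuleCat.{u} R} {f : M →ₗ[R] N}
    {g : LinearMap.ker (cover M) →ₗ[R] LinearMap.ker (cover N)}
    (hg : IsSyzMap f g) (hf : f ∈ projHom R M N) :
    g ∈ projHom R (LinearMap.ker (cover M)) (LinearMap.ker (cover N)) := by
  obtain ⟨P, a, b, hP, rfl⟩ := hf
  obtain ⟨h, hh, hr⟩ := hg
  obtain ⟨c, hc⟩ := Module.projective_lifting_property (cover N) b (cover_surjective N)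
  have hd : ∀ x, (h - c ∘ₗ a ∘ₗ cover M) x ∈ LinearMap.ker (cover N) := by
    intro x
    have h1 := LinearMap.congr_fun hh x
    have h2 := LinearMap.congr_fun hc (a (cover M x))
    simp only [LinearMap.comp_apply] at h1 h2
    simp [LinearMap.mem_ker, h1, h2]
  refine ⟨ModuleCat.of R (Fin (coverRank M) → R), (LinearMap.ker (cover M)).subtype,
    (h - c ∘ₗ a ∘ₗ cover M).codRestrict _ hd,
    inferInstanceAs (Module.Projective R (Fin (coverRank M) → R)), ?_⟩
  ext1 x
  apply Subtype.ext
  have hx : cover M (x : Fin (coverRank M) → R) = 0 := x.2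
  simp [hr, hx]

variable [IsNoetherianRing R]

/-- A chosen representative `Ω M → Ω N` of the syzygy of `f : M → N`. -/
noncomputable def syzMap {M N : FGModuleCat.{u} R} (f : M →ₗ[R] N) : syz M →ₗ[R] syz N :=
  (exists_isSyzMap f).choose

theorem isSyzMap_syzMap {M N : FGModuleCat.{u} R} (f : M →ₗ[R] N) :
    IsSyzMap f (syzMap f) :=
  (exists_isSyzMap f).choose_spec

/-- In the stable category, every syzygy of `f` represents the class of the chosen one. -/
theorem IsSyzMap.mk_eq {M N : FGModuleCat.{u} R} {f : M →ₗ[R] N} {g : syz M →ₗ[R] syz N}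
    (hg : IsSyzMap f g) :
    (projHom R (syz M) (syz N)).mkQ (syzMap f) = (projHom R (syz M) (syz N)).mkQ g := by
  rw [Submodule.mkQ_apply, Submodule.mkQ_apply, Submodule.Quotient.eq]
  have h := (isSyzMap_syzMap f).add (hg.smul (-1))
  have h0 : f + (-1 : R) • f = 0 := by simp
  have h1 : syzMap f - g = syzMap f + (-1 : R) • g := by
    rw [neg_one_smul, sub_eq_add_neg]
  rw [h1]
  exact h.mem_projHom (h0 ▸ Submodule.zero_mem _)

/-- The syzygy functor on the morphisms of the stable category, sending the class of `f` to the
class of `Ω f`. -/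
noncomputable def stableSyz (M N : FGModuleCat.{u} R) :
    StableHom R M N →ₗ[R] StableHom R (syz M) (syz N) :=
  (projHom R M N).liftQ
    { toFun := fun f => (projHom R (syz M) (syz N)).mkQ (syzMap f)
      map_add' := fun f g => by
        rw [← map_add]
        exact ((isSyzMap_syzMap f).add (isSyzMap_syzMap g)).mk_eq
      map_smul' := fun r f => by
        rw [RingHom.id_apply, ← map_smul]
        exact ((isSyzMap_syzMap f).smul r).mk_eq }
    (fun f hf => by
      rw [LinearMap.mem_ker]
      change (projHom R (syz M) (syz N)).mkQ (syzMap f) = 0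
      rw [Submodule.mkQ_apply, Submodule.Quotient.mk_eq_zero]
      exact (isSyzMap_syzMap f).mem_projHom hf)

/-- The iterated syzygy `Ωⁿ M`. -/
noncomputable def syzPow : ℕ → FGModuleCat.{u} R → FGModuleCat.{u} R
  | 0, M => M
  | n + 1, M => syz (syzPow n M)

/-- The `n`-th power of the syzygy functor on the morphisms of the stable category. -/
noncomputable def stableSyzPow : (n : ℕ) → (M N : FGModuleCat.{u} R) →
    (StableHom R M N →ₗ[R] StableHom R (syzPow n M) (syzPow n N))
  | 0, _, _ => LinearMap.id
  | n + 1, M, N => stableSyz (syzPow n M) (syzPow n N) ∘ₗ stableSyzPow n M N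

variable (R)

/-- `Vₙ(M, N)`: the kernel of `Hom(M, N) → StableHom(M, N) → StableHom(Ωⁿ M, Ωⁿ N)`. -/
noncomputable def V (n : ℕ) (M N : Type u) [AddCommGroup M] [Module R M] [Module.Finite R M]
    [AddCommGroup N] [Module R N] [Module.Finite R N] : Submodule R (M →ₗ[R] N) :=
  LinearMap.ker
    (stableSyzPow n (FGModuleCat.of R M) (FGModuleCat.of R N) ∘ₗ (projHom R M N).mkQ)

/-- `M` has an `n`-origin extension: a short exact sequence `0 → X → M ⊕ P → Y → 0` of finitely
generated modules with `P` projective, `pd Y ≤ n`, and `Extⁱ(X, R) = 0` for `1 ≤ i ≤ n`. -/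
def HasOriginExtension (n : ℕ) (M : Type u) [AddCommGroup M] [Module R M] : Prop :=
  ∃ (X P Y : FGModuleCat.{u} R) (f : X →ₗ[R] M × P) (g : M × P →ₗ[R] Y),
    Function.Injective f ∧ Function.Exact f g ∧ Function.Surjective g ∧
    Module.Projective R P ∧
    HasProjectiveDimensionLE (ModuleCat.of R Y) n ∧
    ∀ i : ℕ, 1 ≤ i → i ≤ n →
      Subsingleton (Abelian.Ext.{u} (ModuleCat.of R X) (ModuleCat.of R R) i)

end StableCategory

section Local

variable (R : Type u) [CommRing R] [IsNoetherianRing R] [IsLocalRing R]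

instance : Module.Finite R (IsLocalRing.ResidueField R) :=
  inferInstanceAs (Module.Finite R (R ⧸ IsLocalRing.maximalIdeal R))

/-- `Vₙ(M) = Vₙ(M, k)`, as a subspace of the `k`-vector space `Hom_R(M, k)`. -/
noncomputable def residueV (n : ℕ) (M : Type u) [AddCommGroup M] [Module R M]
    [Module.Finite R M] :
    Submodule (IsLocalRing.ResidueField R) (M →ₗ[R] IsLocalRing.ResidueField R) where
  carrier := V R n M (IsLocalRing.ResidueField R)
  zero_mem' := (V R n M (IsLocalRing.ResidueField R)).zero_mem
  add_mem' := (V R n M (IsLocalRing.ResidueField R)).add_mem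
  smul_mem' := by
    intro c f hf
    obtain ⟨r, rfl⟩ := IsLocalRing.residue_surjective c
    have h : IsLocalRing.residue R r • f = r • f := by
      ext x
      simp only [LinearMap.smul_apply]
      exact algebraMap_smul (IsLocalRing.ResidueField R) r (f x)
    rw [h]
    exact (V R n M (IsLocalRing.ResidueField R)).smul_mem r hf

/-- The `n`-th approximated `ξ`-invariant `ξ_R(n, M) = dim_k Vₙ(M)`. -/
noncomputable def xi (n : ℕ) (M : Type u) [AddCommGroup M] [Module R M] [Module.Finite R M] : ℕ :=
  Module.finrank (IsLocalRing.ResidueField R) (residueV R n M)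

end Local

end StableModule

/-! The submodules `V R n` form a two-sided ideal of maps: they absorb composition on either side.
If pd Z ≤ n, then Ωⁿ Z is projective, so every M → Z lies in this ideal. When such a map is nonzero
after tensoring with k, some functional Z → k detects it, and the composite is a nonzero element of
Vₙ(M, k). This gives (1) ⇒ (2).

For the converse, take φ in Vₙ(M, k) and an origin extension X → M ⊕ P → Y. The composite X → M → k
lies in Vₙ(X, k). Vanishing of Extⁱ(X, R) makes Ωⁿ faithful on stable maps out of X, so this
composite factors through a finite free module F. Push the extension out along X → F: the result Z
is an extension of Y by F, so pd Z ≤ n, and φ factors through M → Z. By (2) that map dies modulo the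
maximal ideal, hence φ = 0. -/

namespace StableModule

/-! ### Ext and short exact sequences -/

section ShortExact

variable {R : Type u} [CommRing R] {A B C : Type u} [AddCommGroup A] [Module R A]
  [AddCommGroup B] [Module R B] [AddCommGroup C] [Module R C]

/-- The short exact sequence in `ModuleCat R` given by linear maps. -/
theorem exists_shortExact {f : A →ₗ[R] B} {g : B →ₗ[R] C} (hf : Function.Injective f)
    (hfg : Function.Exact f g) (hg : Function.Surjective g) :
    ∃ w : ModuleCat.ofHom f ≫ ModuleCat.ofHom g = 0,
      (ShortComplex.mk (ModuleCat.ofHom f) (ModuleCat.ofHom g) w).ShortExact := by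
  refine ⟨?_, ?_⟩
  · ext x
    exact hfg.apply_apply_eq_zero x
  · refine { exact := ?_, mono_f := ?_, epi_g := ?_ }
    · rw [ShortComplex.ShortExact.moduleCat_exact_iff_function_exact]
      exact hfg
    · exact (ModuleCat.mono_iff_injective _).mpr hf
    · exact (ModuleCat.epi_iff_surjective _).mpr hg

/-- Dimension shifting. Degree `i ≥ 1` is needed so that `Ext^i(B, N)` vanishes for projective `B`.
-/
theorem subsingleton_ext_of_shortExact {f : A →ₗ[R] B} {g : B →ₗ[R] C}
    (hf : Function.Injective f) (hfg : Function.Exact f g) (hg : Function.Surjective g)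
    [Module.Projective R B] (N : ModuleCat.{u} R) {i : ℕ} (hi : 1 ≤ i)
    (h : Subsingleton (Abelian.Ext.{u} (ModuleCat.of R C) N (i + 1))) :
    Subsingleton (Abelian.Ext.{u} (ModuleCat.of R A) N i) := by
  obtain ⟨w, hS⟩ := exists_shortExact hf hfg hg
  refine subsingleton_of_forall_eq 0 fun x => ?_
  obtain ⟨j, rfl⟩ : ∃ j, i = j + 1 := ⟨i - 1, by omega⟩
  obtain ⟨y, rfl⟩ := Abelian.Ext.contravariant_sequence_exact₁ hS N x (add_comm 1 (j + 1))
    (h.elim _ _)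
  have : Projective (ModuleCat.of R B) := (IsProjective.iff_projective B).mp inferInstance
  rw [Abelian.Ext.eq_zero_of_projective (P := ModuleCat.of R B) y, Abelian.Ext.comp_zero]

/-- If `Ext¹(C, N) = 0`, then every map `A → N` extends along `A → B`. -/
theorem exists_extension_of_subsingleton_ext {f : A →ₗ[R] B} {g : B →ₗ[R] C}
    (hf : Function.Injective f) (hfg : Function.Exact f g) (hg : Function.Surjective g)
    {N : Type u} [AddCommGroup N] [Module R N]
    (h : Subsingleton (Abelian.Ext.{u} (ModuleCat.of R C) (ModuleCat.of R N) 1))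
    (a : A →ₗ[R] N) : ∃ b : B →ₗ[R] N, b ∘ₗ f = a := by
  obtain ⟨w, hS⟩ := exists_shortExact hf hfg hg
  obtain ⟨y, hy⟩ := Abelian.Ext.contravariant_sequence_exact₁ hS (ModuleCat.of R N)
    (Abelian.Ext.mk₀ (ModuleCat.ofHom a)) (add_zero 1) (h.elim _ _)
  obtain ⟨y, rfl⟩ := Abelian.Ext.homEquiv₀.symm.surjective y
  refine ⟨y.hom, ?_⟩
  have key : ModuleCat.ofHom f ≫ y = ModuleCat.ofHom a :=
    Abelian.Ext.homEquiv₀.symm.injective (by simpa using hy)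
  simpa using congrArg ModuleCat.Hom.hom key

end ShortExact

/-! ### Maps through projectives, and functoriality of Ωⁿ -/

section Functoriality

variable {R : Type u} [CommRing R]

theorem projHom_comp_left {A B C : Type u} [AddCommGroup A] [Module R A]
    [AddCommGroup B] [Module R B] [AddCommGroup C] [Module R C]
    {f : A →ₗ[R] B} (hf : f ∈ projHom R A B) (g : B →ₗ[R] C) : g ∘ₗ f ∈ projHom R A C := by
  obtain ⟨P, a, b, hP, rfl⟩ := hf
  exact ⟨P, a, g ∘ₗ b, hP, rfl⟩

theorem projHom_comp_right {A B C : Type u} [AddCommGroup A] [Module R A]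
    [AddCommGroup B] [Module R B] [AddCommGroup C] [Module R C]
    {g : B →ₗ[R] C} (hg : g ∈ projHom R B C) (f : A →ₗ[R] B) : g ∘ₗ f ∈ projHom R A C := by
  obtain ⟨P, a, b, hP, rfl⟩ := hg
  exact ⟨P, a ∘ₗ f, b, hP, rfl⟩

theorem mem_projHom_of_projective_right {A B : Type u} [AddCommGroup A] [Module R A]
    [AddCommGroup B] [Module R B] (hB : Module.Projective R B) (f : A →ₗ[R] B) :
    f ∈ projHom R A B :=
  ⟨ModuleCat.of R B, f, LinearMap.id, hB, rfl⟩

/-- A map into a finitely generated module that factors through a projective module factors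
through the chosen free cover of its target. -/
theorem exists_cover_comp_eq {A : Type u} [AddCommGroup A] [Module R A] {N : FGModuleCat.{u} R}
    {f : A →ₗ[R] N} (hf : f ∈ projHom R A N) :
    ∃ a : A →ₗ[R] (Fin (coverRank N) → R), cover N ∘ₗ a = f := by
  obtain ⟨P, a, b, hP, rfl⟩ := hf
  obtain ⟨c, hc⟩ := Module.projective_lifting_property (cover N) b (cover_surjective N)
  exact ⟨c ∘ₗ a, by rw [← LinearMap.comp_assoc, hc]⟩

theorem exact_subtype_cover (M : FGModuleCat.{u} R) :
    Function.Exact (LinearMap.ker (cover M)).subtype (cover M) := by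
  rw [LinearMap.exact_iff, Submodule.range_subtype]

theorem IsSyzMap.comp {L M N : FGModuleCat.{u} R} {f : L →ₗ[R] M} {f' : M →ₗ[R] N}
    {g : LinearMap.ker (cover L) →ₗ[R] LinearMap.ker (cover M)}
    {g' : LinearMap.ker (cover M) →ₗ[R] LinearMap.ker (cover N)}
    (hg : IsSyzMap f g) (hg' : IsSyzMap f' g') : IsSyzMap (f' ∘ₗ f) (g' ∘ₗ g) := by
  obtain ⟨h, hh, hr⟩ := hg
  obtain ⟨h', hh', hr'⟩ := hg'
  refine ⟨h' ∘ₗ h, ?_, fun x => by simp [hr, hr']⟩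
  rw [← LinearMap.comp_assoc, hh', LinearMap.comp_assoc, hh, LinearMap.comp_assoc]

variable [IsNoetherianRing R]

/-- The `n`-fold iterate of `syzMap`. -/
noncomputable def syzPowMap : (n : ℕ) → {M N : FGModuleCat.{u} R} → (M →ₗ[R] N) →
    (syzPow n M →ₗ[R] syzPow n N)
  | 0, _, _, f => f
  | n + 1, _, _, f => syzMap (syzPowMap n f)

theorem stableSyz_mkQ {M N : FGModuleCat.{u} R} (f : M →ₗ[R] N) :
    stableSyz M N ((projHom R M N).mkQ f) = (projHom R (syz M) (syz N)).mkQ (syzMap f) :=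
  rfl

theorem stableSyzPow_mkQ (n : ℕ) {M N : FGModuleCat.{u} R} (f : M →ₗ[R] N) :
    stableSyzPow n M N ((projHom R M N).mkQ f) =
      (projHom R (syzPow n M) (syzPow n N)).mkQ (syzPowMap n f) := by
  induction n with
  | zero => rfl
  | succ n ih =>
    change stableSyz _ _ (stableSyzPow n M N _) = _
    rw [ih]
    rfl

/-- Lifts are chosen separately for each map, so Ωⁿ respects composition only modulo maps through
projectives. -/
theorem syzPowMap_comp_sub_mem (n : ℕ) {L M N : FGModuleCat.{u} R} (f : L →ₗ[R] M)
    (g : M →ₗ[R] N) :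
    syzPowMap n (g ∘ₗ f) - syzPowMap n g ∘ₗ syzPowMap n f ∈
      projHom R (syzPow n L) (syzPow n N) := by
  induction n with
  | zero =>
    change g ∘ₗ f - g ∘ₗ f ∈ _
    rw [sub_self]
    exact Submodule.zero_mem _
  | succ n ih =>
    have h1 : (projHom R (syzPow n L) (syzPow n N)).mkQ (syzPowMap n (g ∘ₗ f)) =
        (projHom R (syzPow n L) (syzPow n N)).mkQ (syzPowMap n g ∘ₗ syzPowMap n f) :=
      (Submodule.Quotient.eq _).mpr ih
    have h2 := congrArg (stableSyz _ _) h1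
    rw [stableSyz_mkQ, stableSyz_mkQ] at h2
    have h3 := ((isSyzMap_syzMap (syzPowMap n f)).comp (isSyzMap_syzMap (syzPowMap n g))).mk_eq
    exact (Submodule.Quotient.eq _).mp (h2.trans h3)

theorem mem_V_iff (n : ℕ) {M N : Type u} [AddCommGroup M] [Module R M] [Module.Finite R M]
    [AddCommGroup N] [Module R N] [Module.Finite R N] (f : M →ₗ[R] N) :
    f ∈ V R n M N ↔
      syzPowMap n (M := FGModuleCat.of R M) (N := FGModuleCat.of R N) f ∈
        projHom R (syzPow n (FGModuleCat.of R M)) (syzPow n (FGModuleCat.of R N)) := by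
  rw [← Submodule.Quotient.mk_eq_zero (projHom R _ _), ← Submodule.mkQ_apply]
  exact (stableSyzPow_mkQ n (M := FGModuleCat.of R M) (N := FGModuleCat.of R N) f) ▸ Iff.rfl

theorem V_comp_left (n : ℕ) {L M N : Type u} [AddCommGroup L] [Module R L] [Module.Finite R L]
    [AddCommGroup M] [Module R M] [Module.Finite R M]
    [AddCommGroup N] [Module R N] [Module.Finite R N] {f : L →ₗ[R] M}
    (hf : f ∈ V R n L M) (g : M →ₗ[R] N) : g ∘ₗ f ∈ V R n L N := by
  rw [mem_V_iff] at hf ⊢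
  rw [← Submodule.sub_mem_iff_left _ (projHom_comp_left hf (syzPowMap n
    (M := FGModuleCat.of R M) (N := FGModuleCat.of R N) g))]
  exact syzPowMap_comp_sub_mem n (L := FGModuleCat.of R L) (M := FGModuleCat.of R M)
    (N := FGModuleCat.of R N) f g

theorem V_comp_right (n : ℕ) {L M N : Type u} [AddCommGroup L] [Module R L] [Module.Finite R L]
    [AddCommGroup M] [Module R M] [Module.Finite R M]
    [AddCommGroup N] [Module R N] [Module.Finite R N] {g : M →ₗ[R] N}
    (hg : g ∈ V R n M N) (f : L →ₗ[R] M) : g ∘ₗ f ∈ V R n L N := by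
  rw [mem_V_iff] at hg ⊢
  rw [← Submodule.sub_mem_iff_left _ (projHom_comp_right hg (syzPowMap n
    (M := FGModuleCat.of R L) (N := FGModuleCat.of R M) f))]
  exact syzPowMap_comp_sub_mem n (L := FGModuleCat.of R L) (M := FGModuleCat.of R M)
    (N := FGModuleCat.of R N) f g

end Functoriality

/-! ### Projective dimension, Ext vanishing and faithfulness of Ω -/

section Syzygies

variable {R : Type u} [CommRing R] [IsNoetherianRing R]

/-- The `n`-th syzygy of a module of projective dimension at most `n` is projective. -/
theorem projective_syzPow (n : ℕ) (M : FGModuleCat.{u} R)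
    (h : HasProjectiveDimensionLE (ModuleCat.of R M) n) :
    Module.Projective R (syzPow n M) := by
  -- Each syzygy lowers the bound on the projective dimension by one.
  have key : ∀ i j : ℕ, i + j = n →
      HasProjectiveDimensionLE (ModuleCat.of R (syzPow i M)) j := by
    intro i
    induction i with
    | zero => rintro j hj; obtain rfl : j = n := by omega
              exact h
    | succ i ih =>
      intro j hj
      have hi := ih (j + 1) (by omega)
      obtain ⟨w, hS⟩ := exists_shortExact
        (LinearMap.ker (cover (syzPow i M))).injective_subtype
        (exact_subtype_cover (syzPow i M)) (cover_surjective (syzPow i M))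
      have : Projective (ModuleCat.of R (Fin (coverRank (syzPow i M)) → R)) :=
        (IsProjective.iff_projective _).mp inferInstance
      exact (hS.hasProjectiveDimensionLT_X₃_iff j this).mp hi
  have h0 := key n 0 (by omega)
  rw [IsProjective.iff_projective]
  exact (projective_iff_hasProjectiveDimensionLE_zero _).mpr h0

theorem mem_V_of_hasProjectiveDimensionLE (n : ℕ) {M Z : Type u} [AddCommGroup M] [Module R M]
    [Module.Finite R M] [AddCommGroup Z] [Module R Z] [Module.Finite R Z]
    (hZ : HasProjectiveDimensionLE (ModuleCat.of R Z) n) (f : M →ₗ[R] Z) : f ∈ V R n M Z := by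
  rw [mem_V_iff]
  exact mem_projHom_of_projective_right (projective_syzPow n (FGModuleCat.of R Z) hZ) _

/-- Each syzygy shifts degrees by one, so the range of vanishing shrinks by `j`. -/
theorem subsingleton_ext_syzPow (M N : FGModuleCat.{u} R) (n : ℕ)
    (h : ∀ i : ℕ, 1 ≤ i → i ≤ n →
      Subsingleton (Abelian.Ext.{u} (ModuleCat.of R M) (ModuleCat.of R N) i))
    (j : ℕ) : ∀ i : ℕ, 1 ≤ i → i + j ≤ n →
      Subsingleton (Abelian.Ext.{u} (ModuleCat.of R (syzPow j M)) (ModuleCat.of R N) i) := by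
  induction j with
  | zero => exact h
  | succ j ih =>
    intro i hi hij
    exact subsingleton_ext_of_shortExact (LinearMap.ker (cover (syzPow j M))).injective_subtype
      (exact_subtype_cover (syzPow j M)) (cover_surjective (syzPow j M)) _ hi
      (ih (i + 1) (by omega) (by omega))

/-- If `Ext¹(M, R) = 0`, then the syzygy functor is faithful on stable maps out of `M`. -/
theorem mem_projHom_of_syzMap_mem {M N : FGModuleCat.{u} R}
    (h : Subsingleton (Abelian.Ext.{u} (ModuleCat.of R M) (ModuleCat.of R R) 1))
    {f : M →ₗ[R] N} (hf : syzMap f ∈ projHom R (syz M) (syz N)) : f ∈ projHom R M N := by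
  obtain ⟨a, ha⟩ := exists_cover_comp_eq hf
  obtain ⟨l, hl, hr⟩ := isSyzMap_syzMap f
  -- Ext vanishes against `R`, so `a` is extended to the cover of `M` one coordinate at a time.
  have hext : ∀ i, ∃ b : (Fin (coverRank M) → R) →ₗ[R] R,
      b ∘ₗ (LinearMap.ker (cover M)).subtype = LinearMap.proj i ∘ₗ a := fun i =>
    exists_extension_of_subsingleton_ext (LinearMap.ker (cover M)).injective_subtype
      (exact_subtype_cover M) (cover_surjective M) h _
  choose b hb using hext
  -- Correct the lift `l` of `f` by a map into `ker (cover N)`: the result still lifts `f`, but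
  -- kills Ω M and so descends to `M`.
  let d : (Fin (coverRank M) → R) →ₗ[R] (Fin (coverRank N) → R) :=
    l - (LinearMap.ker (cover N)).subtype ∘ₗ cover (syz N) ∘ₗ LinearMap.pi b
  have hd : LinearMap.ker (cover M) ≤ LinearMap.ker d := by
    intro x hx
    have h1 : LinearMap.pi b x = a ⟨x, hx⟩ := by
      funext i
      exact LinearMap.congr_fun (hb i) ⟨x, hx⟩
    have h2 : cover (syz N) (a ⟨x, hx⟩) = syzMap f ⟨x, hx⟩ := LinearMap.congr_fun ha ⟨x, hx⟩
    have h3 := hr ⟨x, hx⟩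
    rw [LinearMap.mem_ker]
    change l x - (LinearMap.ker (cover N)).subtype (cover (syz N) (LinearMap.pi b x)) = 0
    rw [h1, h2]
    exact sub_eq_zero.mpr h3.symm
  obtain ⟨e, he⟩ : ∃ e : M →ₗ[R] (Fin (coverRank N) → R), e ∘ₗ cover M = d := by
    refine ⟨(LinearMap.ker (cover M)).liftQ d hd ∘ₗ
      ((cover M).quotKerEquivOfSurjective (cover_surjective M)).symm.toLinearMap, ?_⟩
    apply LinearMap.ext
    intro x
    have h1 : ((cover M).quotKerEquivOfSurjective (cover_surjective M)).symm (cover M x) =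
        Submodule.Quotient.mk x := by
      rw [LinearEquiv.symm_apply_eq]
      rfl
    simp [h1]
  refine ⟨ModuleCat.of R (Fin (coverRank N) → R), e, cover N,
    inferInstanceAs (Module.Projective R (Fin (coverRank N) → R)), ?_⟩
  ext m
  obtain ⟨x, rfl⟩ := cover_surjective M m
  have h1 : e (cover M x) = d x := LinearMap.congr_fun he x
  have h2 : cover N (l x) = f (cover M x) := LinearMap.congr_fun hl x
  have h3 : cover N ((LinearMap.ker (cover N)).subtype (cover (syz N) (LinearMap.pi b x))) = 0 :=
    LinearMap.mem_ker.mp (cover (syz N) (LinearMap.pi b x)).2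
  change f (cover M x) = cover N (e (cover M x))
  rw [h1]
  change _ = cover N (l x - (LinearMap.ker (cover N)).subtype (cover (syz N) (LinearMap.pi b x)))
  rw [map_sub, h2, h3, sub_zero]

theorem mem_projHom_of_mem_V (n : ℕ) {M N : Type u} [AddCommGroup M] [Module R M]
    [Module.Finite R M] [AddCommGroup N] [Module R N] [Module.Finite R N]
    (h : ∀ i : ℕ, 1 ≤ i → i ≤ n →
      Subsingleton (Abelian.Ext.{u} (ModuleCat.of R M) (ModuleCat.of R R) i))
    {f : M →ₗ[R] N} (hf : f ∈ V R n M N) : f ∈ projHom R M N := by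
  rw [mem_V_iff] at hf
  have key : ∀ j : ℕ, j ≤ n →
      syzPowMap j (M := FGModuleCat.of R M) (N := FGModuleCat.of R N) f ∈
        projHom R (syzPow j (FGModuleCat.of R M)) (syzPow j (FGModuleCat.of R N)) →
      f ∈ projHom R M N := by
    intro j
    induction j with
    | zero => exact fun _ h => h
    | succ j ih =>
      intro hj hfj
      exact ih (by omega) (mem_projHom_of_syzMap_mem
        (subsingleton_ext_syzPow (FGModuleCat.of R M) (FGModuleCat.of R R) n h j 1 le_rfl
          (by omega)) hfj)
  exact key n le_rfl hf

end Syzygies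

/-- A module of projective dimension at most `n` obtained by pushing out a short exact sequence
along a map to a finite free module. -/
theorem exists_pushout {R : Type u} [CommRing R] {X E Y F : Type u} [AddCommGroup X] [Module R X]
    [AddCommGroup E] [Module R E] [Module.Finite R E] [AddCommGroup Y] [Module R Y]
    [AddCommGroup F] [Module R F] [Module.Finite R F] [Module.Projective R F]
    {f : X →ₗ[R] E} {g : E →ₗ[R] Y} (hf : Function.Injective f) (hfg : Function.Exact f g)
    (hg : Function.Surjective g) {n : ℕ} (hY : HasProjectiveDimensionLE (ModuleCat.of R Y) n)
    (a : X →ₗ[R] F) {K : Type u} [AddCommGroup K] [Module R K] (c : E →ₗ[R] K) (b : F →ₗ[R] K)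
    (hbc : b ∘ₗ a = c ∘ₗ f) :
    ∃ (Z : Type u) (_ : AddCommGroup Z) (_ : Module R Z), Module.Finite R Z ∧
      HasProjectiveDimensionLE (ModuleCat.of R Z) n ∧
      ∃ (e : E →ₗ[R] Z) (d : Z →ₗ[R] K), d ∘ₗ e = c := by
  -- The quotient by this twisted image of `X` is the pushout of `a` and `f`.
  let S : Submodule R (F × E) := LinearMap.range (a.prod (-f))
  have hS0 : S ≤ LinearMap.ker (g ∘ₗ LinearMap.snd R F E) := by
    rintro _ ⟨x, rfl⟩
    simp [hfg.apply_apply_eq_zero]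
  have hSK : S ≤ LinearMap.ker (b.coprod c) := by
    rintro _ ⟨x, rfl⟩
    have := LinearMap.congr_fun hbc x
    simp only [LinearMap.comp_apply] at this
    simp [this]
  refine ⟨(F × E) ⧸ S, inferInstance, inferInstance, inferInstance, ?_,
    S.mkQ ∘ₗ LinearMap.inr R F E, S.liftQ _ hSK, ?_⟩
  -- The bound on pd comes from the sequence 0 → F → Z → Y → 0; injectivity on the left is inherited
  -- from `f`.
  · have h1 : Function.Injective (S.mkQ ∘ₗ LinearMap.inl R F E) := by
      rw [← LinearMap.ker_eq_bot, LinearMap.ker_eq_bot']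
      intro q hq
      obtain ⟨x, hx⟩ := (Submodule.Quotient.mk_eq_zero S).mp hq
      obtain ⟨hx1, hx2⟩ := Prod.ext_iff.mp hx
      have hx3 : x = 0 := hf (by simpa using hx2)
      simpa [hx3] using hx1.symm
    have h2 : Function.Exact (S.mkQ ∘ₗ LinearMap.inl R F E) (S.liftQ _ hS0) := by
      intro z
      constructor
      · intro hz
        obtain ⟨⟨q, y⟩, rfl⟩ := S.mkQ_surjective z
        obtain ⟨x, rfl⟩ := (hfg y).mp hz
        refine ⟨q + a x, ?_⟩
        refine (Submodule.Quotient.eq S).mpr ⟨x, ?_⟩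
        simp
      · rintro ⟨q, rfl⟩
        simp
    have h3 : Function.Surjective (S.liftQ _ hS0) := by
      intro y
      obtain ⟨x, rfl⟩ := hg y
      exact ⟨S.mkQ (0, x), rfl⟩
    obtain ⟨w, hS⟩ := exists_shortExact h1 h2 h3
    have : Projective (ModuleCat.of R F) := (IsProjective.iff_projective _).mp inferInstance
    exact hS.hasProjectiveDimensionLT_X₂ (n + 1)
      (hasProjectiveDimensionLT_of_ge (ModuleCat.of R F) 1 (n + 1) (by omega)) hY
  · ext x
    simp

/-! ### Detecting maps modulo the maximal ideal -/

section Local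

variable {R : Type u} [CommRing R] [IsLocalRing R]

open IsLocalRing

theorem apply_eq_zero_of_rTensor_eq_zero {M Z : Type u} [AddCommGroup M] [Module R M]
    [AddCommGroup Z] [Module R Z] {f : M →ₗ[R] Z}
    (hf : f.rTensor (ResidueField R) = 0) (d : Z →ₗ[R] ResidueField R) : d ∘ₗ f = 0 := by
  ext m
  have h : d.rTensor (ResidueField R) (f.rTensor (ResidueField R) (m ⊗ₜ[R] 1)) = 0 := by
    rw [hf]; simp
  -- Multiplication k ⊗ k → k turns `d (f m) ⊗ 1` back into `d (f m)`.
  have h' := congrArg (Algebra.TensorProduct.lmul' R (S := ResidueField R)) h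
  simpa using h'

theorem exists_comp_ne_zero_of_rTensor_ne_zero {M Z : Type u} [AddCommGroup M] [Module R M]
    [AddCommGroup Z] [Module R Z] {f : M →ₗ[R] Z}
    (hf : f.rTensor (ResidueField R) ≠ 0) : ∃ d : Z →ₗ[R] ResidueField R, d ∘ₗ f ≠ 0 := by
  obtain ⟨m, hm⟩ : ∃ m, (1 : ResidueField R) ⊗ₜ[R] f m ≠ 0 := by
    by_contra! h
    apply hf
    ext m c
    apply (TensorProduct.comm R Z (ResidueField R)).injective
    have hc : c ⊗ₜ[R] f m = c • ((1 : ResidueField R) ⊗ₜ[R] f m) := by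
      rw [TensorProduct.smul_tmul', smul_eq_mul, mul_one]
    simp [hc, h m]
  -- Functionals on the k-vector space k ⊗ Z separate its points.
  obtain ⟨φ, hφ⟩ := Module.Projective.exists_dual_ne_zero (ResidueField R) hm
  refine ⟨φ.restrictScalars R ∘ₗ TensorProduct.mk R (ResidueField R) Z 1, fun h => hφ ?_⟩
  exact LinearMap.congr_fun h m

variable [IsNoetherianRing R]

theorem xi_eq_zero_iff (n : ℕ) (M : Type u) [AddCommGroup M] [Module R M] [Module.Finite R M] :
    xi R n M = 0 ↔ ∀ f ∈ V R n M (ResidueField R), f = 0 := by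
  -- Without finiteness, `finrank` could be 0 by default on a nonzero space.
  have : Module.Finite (ResidueField R) (M →ₗ[R] ResidueField R) :=
    Module.Finite.of_restrictScalars_finite R _ _
  rw [xi, Submodule.finrank_eq_zero, Submodule.eq_bot_iff]
  rfl

end Local

end StableModule

theorem theorem4p14 (R : Type u) [CommRing R] [IsNoetherianRing R] [IsLocalRing R]
    (M : Type u) [AddCommGroup M] [Module R M] [Module.Finite R M] (n : ℕ) :
    (StableModule.xi R n M = 0 →
      ∀ (Z : Type u) [AddCommGroup Z] [Module R Z] [Module.Finite R Z],
        HasProjectiveDimensionLE (ModuleCat.of R Z) n →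
        ∀ f : M →ₗ[R] Z, f.rTensor (IsLocalRing.ResidueField R) = 0) ∧
    (StableModule.HasOriginExtension R n M →
      (∀ (Z : Type u) [AddCommGroup Z] [Module R Z] [Module.Finite R Z],
        HasProjectiveDimensionLE (ModuleCat.of R Z) n →
        ∀ f : M →ₗ[R] Z, f.rTensor (IsLocalRing.ResidueField R) = 0) →
      StableModule.xi R n M = 0) := by
  rw [StableModule.xi_eq_zero_iff]
  constructor
  · intro h Z _ _ _ hZ f
    by_contra hf
    obtain ⟨d, hd⟩ := StableModule.exists_comp_ne_zero_of_rTensor_ne_zero hf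
    exact hd (h _ (StableModule.V_comp_left n
      (StableModule.mem_V_of_hasProjectiveDimensionLE n hZ f) d))
  · rintro ⟨X, P, Y, f, g, hf, hfg, hg, hP, hY, hX⟩ h φ hφ
    have hα := StableModule.mem_projHom_of_mem_V n hX
      (StableModule.V_comp_right n hφ (LinearMap.fst R M P ∘ₗ f))
    obtain ⟨a, ha⟩ := StableModule.exists_cover_comp_eq
      (N := FGModuleCat.of R (IsLocalRing.ResidueField R)) hα
    obtain ⟨Z, _, _, _, hZ, e, d, hde⟩ := StableModule.exists_pushout hf hfg hg hY a
      (φ ∘ₗ LinearMap.fst R M P)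
      (StableModule.cover (FGModuleCat.of R (IsLocalRing.ResidueField R))) ha
    have h0 := StableModule.apply_eq_zero_of_rTensor_eq_zero
      (h Z hZ (e ∘ₗ LinearMap.inl R M P)) d
    -- Restricted to the summand `M`, the factorization `d ∘ e` is `φ` itself.
    rw [← LinearMap.comp_assoc, hde] at h0
    simpa [LinearMap.comp_assoc] using h0
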